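/- Let $G=(V,E)$ be a finite connected undirected graph with $N=|V|$ vertices (the agents), let $A=\{1,\dots,K\}$, $K\ge 1$, be a set of actions, let $d\ge 0$ be an integer (the delay), let $\gamma\in(0,1]$ and put $\eta=\gamma/\bigl(Ke(d+1)\bigr)$. Let $\ell_t=(\ell_t(1),\dots,\ell_t(K))\in[0,1]^K$, $t=1,2,\dots$, be an arbitrary sequence of loss vectors fixed in advance (oblivious adversary). Write $N_{\le d}(v)$ for the set of vertices at shortest-path distance at most $d$ from $v$ (so $v\in N_{\le d}(v)$). The algorithm Exp3-Coop runs as follows. Initially $w_1(i,v)=1$ for all $i\in A$, $v\in V$. At each round $t=1,2,\dots$, conditionally on all actions played at rounds $1,\dots,t-1$, the agents independently draw actions $I_t(v)\in A$, agent $v$ playing $i$ with probability $p_t(i,v)=w_t(i,v)/\sum_{j\in A}w_t(j,v)$. Then each agent $v$ sets $$w_{t+1}(i,v)=p_t(i,v)\exp\bigl(-\eta\,\widehat{\ell}_t(i,v)\bigr),\qquad i\in A,$$ where $\widehat{\ell}_t(i,v)=0$ if $t\le d$, and, if $t>d$, $$\widehat{\ell}_t(i,v)=\frac{\ell_{t-d}(i)}{q_{d,t-d}(i,v)}\,B_{d,t-d}(i,v),\qquad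 q_{d,s}(i,v)=1-\prod_{v'\in N_{\le d}(v)}\bigl(1-p_s(i,v')\bigr),$$ with $B_{d,s}(i,v)=1$ if some $v'\in N_{\le d}(v)$ has $I_s(v')=i$, and $B_{d,s}(i,v)=0$ otherwise. Then for every $T\ge 0$ the average welfare regret $$R_T^{\mathrm{coop}}=\frac1N\sum_{v\in V}\mathbb{E}\Bigl[\sum_{t=1}^T\ell_t\bigl(I_t(v)\bigr)\Bigr]-\min_{i\in A}\sum_{t=1}^T\ell_t(i)$$ satisfies $$R_T^{\mathrm{coop}}\le 2d+\frac{Ke(d+1)\ln K}{\gamma}+\gamma\left(\frac{\alpha(G_{\le d})}{2(1-e^{-1})(d+1)N}+\frac{3}{Ke}\right)T,$$ where $G_{\le d}$ is the graph on $V$ in which two distinct vertices are adjacent if and only if their shortest-path distance in $G$ is at most $d$, and $\alpha(G_{\le d})$ is its independence number. -/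

import Mathlib

open MeasureTheory

noncomputable section

namespace Exp3Coop

variable {V : Type*} [Fintype V] {K : ℕ}

/-- The `d`-th power `G_{≤ d}` of a graph: distinct vertices are adjacent when their
shortest-path distance in `G` is at most `d`. In particular `G_{≤ 0}` has no edges. -/
def graphPower (G : SimpleGraph V) (d : ℕ) : SimpleGraph V where
  Adj u v := u ≠ v ∧ G.edist u v ≤ d
  symm := ⟨fun u v h => ⟨h.1.symm, by rw [G.edist_comm]; exact h.2⟩⟩
  loopless := ⟨fun _ h => h.1 rfl⟩

open Classical in
/-- The set `N_{≤ d}(v)` of vertices at shortest-path distance at most `d` from `v`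
(including `v` itself). -/
def nbhd (G : SimpleGraph V) (d : ℕ) (v : V) : Finset V :=
  Finset.univ.filter fun v' => G.edist v v' ≤ d

/-- The distributions `p(i,v) = w(i,v) / ∑_j w(j,v)` given by a table `w` of weights. -/
def normalize (w : Fin K → V → ℝ) (i : Fin K) (v : V) : ℝ :=
  w i v / ∑ j, w j v

open Classical in
/-- The indicator `B_d(i,v)` of the event that, under the action profile `a`, some agent
within distance `d` of `v` plays action `i`. -/
def playedInd (G : SimpleGraph V) (d : ℕ) (a : V → Fin K) (i : Fin K) (v : V) : ℝ :=
  if ∃ v' ∈ nbhd G d v, a v' = i then 1 else 0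

/-- The probability `q_d(i,v) = 1 - ∏_{v' ∈ N_{≤ d}(v)} (1 - p(i,v'))` that some agent within
distance `d` of `v` plays action `i`, when each agent `v'` draws from `p(·,v')` independently. -/
def playedProb (G : SimpleGraph V) (d : ℕ) (p : Fin K → V → ℝ) (i : Fin K) (v : V) : ℝ :=
  1 - ∏ v' ∈ nbhd G d v, (1 - p i v')

/-- The weights `w_t(i,v)` that Exp3-Coop with delay `d` and learning rate `η` computes for the
loss sequence `ℓ` when the agents play the actions `I t v`. Rounds are `t = 1, 2, …`; the value
at `t = 0` is a placeholder. The defining equations in terms of the distributions `prob` and the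
loss estimates `lossEst` are `weight_one` and `weight_succ`. -/
def weight (G : SimpleGraph V) (d : ℕ) (η : ℝ) (ℓ : ℕ → Fin K → ℝ) (I : ℕ → V → Fin K) :
    ℕ → Fin K → V → ℝ
  | 0 => fun _ _ => 1
  | 1 => fun _ _ => 1
  | t + 2 => fun i v =>
      normalize (weight G d η ℓ I (t + 1)) i v *
        Real.exp (-η * if d < t + 1 then
          ℓ (t + 1 - d) i / playedProb G d (normalize (weight G d η ℓ I (t + 1 - d))) i v *
            playedInd G d (I (t + 1 - d)) i v
        else 0)

/-- The probability `p_t(i,v)` with which agent `v` plays action `i` at round `t`. -/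
def prob (G : SimpleGraph V) (d : ℕ) (η : ℝ) (ℓ : ℕ → Fin K → ℝ) (I : ℕ → V → Fin K)
    (t : ℕ) (i : Fin K) (v : V) : ℝ :=
  normalize (weight G d η ℓ I t) i v

/-- The delayed importance-weighted loss estimate of agent `v` for action `i` at round `t`. -/
def lossEst (G : SimpleGraph V) (d : ℕ) (η : ℝ) (ℓ : ℕ → Fin K → ℝ) (I : ℕ → V → Fin K)
    (t : ℕ) (i : Fin K) (v : V) : ℝ :=
  if d < t then
    ℓ (t - d) i / playedProb G d (prob G d η ℓ I (t - d)) i v * playedInd G d (I (t - d)) i v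
  else 0

theorem weight_one (G : SimpleGraph V) (d : ℕ) (η : ℝ) (ℓ : ℕ → Fin K → ℝ)
    (I : ℕ → V → Fin K) (i : Fin K) (v : V) : weight G d η ℓ I 1 i v = 1 := by
  rw [weight]

theorem weight_succ (G : SimpleGraph V) (d : ℕ) (η : ℝ) (ℓ : ℕ → Fin K → ℝ)
    (I : ℕ → V → Fin K) {t : ℕ} (ht : 1 ≤ t) (i : Fin K) (v : V) :
    weight G d η ℓ I (t + 1) i v =
      prob G d η ℓ I t i v * Real.exp (-η * lossEst G d η ℓ I t i v) := by
  obtain ⟨s, rfl⟩ : ∃ s, t = s + 1 := ⟨t - 1, by omega⟩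
  rw [weight]
  rfl

theorem weight_congr (G : SimpleGraph V) (d : ℕ) (η : ℝ) (ℓ : ℕ → Fin K → ℝ)
    (I J : ℕ → V → Fin K) (t : ℕ) (h : ∀ s, 1 ≤ s → s < t → I s = J s) :
    weight G d η ℓ I t = weight G d η ℓ J t := by
  induction t using Nat.strong_induction_on with
  | _ t ih =>
    match t with
    | 0 => simp [weight]
    | 1 => simp [weight]
    | s + 2 =>
      funext i v
      rw [weight, weight]
      rw [ih (s+1) (by omega) (fun r h1 h2 => h r h1 (by omega))]
      split_ifs with hd
      · rw [ih (s+1-d) (by omega) (fun r h1 h2 => h r h1 (by omega)),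
          h (s+1-d) (by omega) (by omega)]
      · rfl

theorem normalize_pos {V : Type*} {K : ℕ} [NeZero K] (w : Fin K → V → ℝ) (hw : ∀ i v, 0 < w i v) (i v) :
    0 < normalize w i v := by
  unfold normalize
  exact div_pos (hw i v) (Finset.sum_pos (fun j _ => hw j v) Finset.univ_nonempty)

theorem weight_pos [NeZero K] (G : SimpleGraph V) (d : ℕ) (η : ℝ) (ℓ : ℕ → Fin K → ℝ)
    (I : ℕ → V → Fin K) (t : ℕ) : ∀ i v, 0 < weight G d η ℓ I t i v := by
  induction t using Nat.strong_induction_on with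
  | _ t ih =>
    match t with
    | 0 => simp [weight]
    | 1 => simp [weight]
    | s + 2 =>
      intro i v
      rw [weight]
      exact mul_pos (normalize_pos _ (ih (s+1) (by omega)) i v) (Real.exp_pos _)

theorem sum_prob [NeZero K] (G : SimpleGraph V) (d : ℕ) (η : ℝ) (ℓ : ℕ → Fin K → ℝ)
    (I : ℕ → V → Fin K) (t : ℕ) (v) : ∑ i, prob G d η ℓ I t i v = 1 := by
  unfold prob normalize
  rw [← Finset.sum_div, div_self]
  exact (Finset.sum_pos (fun j _ => weight_pos G d η ℓ I t j v) Finset.univ_nonempty).ne'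

/-- Extends a history of rounds `≤ n` to all rounds. -/
def extend (n : ℕ) [NeZero K] (x : (i : Finset.Iic n) → V → Fin K) : ℕ → V → Fin K :=
  fun s => if h : s ≤ n then x ⟨s, Finset.mem_Iic.2 h⟩ else 0

/-- The product distribution of the action profile at round `t`. -/
def profilePMF [NeZero K] [DecidableEq V] (G : SimpleGraph V) (d : ℕ) (η : ℝ) (ℓ : ℕ → Fin K → ℝ)
    (I : ℕ → V → Fin K) (t : ℕ) : PMF (V → Fin K) :=
  PMF.ofFintype (fun a => ENNReal.ofReal (∏ v, prob G d η ℓ I t (a v) v)) (by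
    rw [← ENNReal.ofReal_sum_of_nonneg]
    · rw [← Fintype.prod_sum (fun v i => prob G d η ℓ I t i v)]
      simp [sum_prob]
    · exact fun a _ => Finset.prod_nonneg fun v _ => (normalize_pos _ (weight_pos G d η ℓ I t) _ _).le)

/-- The transition kernel from histories to the action profile of the next round. -/
def stepKernel [NeZero K] [DecidableEq V] (G : SimpleGraph V) (d : ℕ) (η : ℝ) (ℓ : ℕ → Fin K → ℝ) (n : ℕ) :
    ProbabilityTheory.Kernel ((i : Finset.Iic n) → V → Fin K) (V → Fin K) :=
  ProbabilityTheory.Kernel.ofFunOfCountable fun x => (profilePMF G d η ℓ (extend n x) (n+1)).toMeasure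

instance [NeZero K] [DecidableEq V] (G : SimpleGraph V) (d : ℕ) (η : ℝ) (ℓ : ℕ → Fin K → ℝ) (n : ℕ) :
    ProbabilityTheory.IsMarkovKernel (stepKernel G d η ℓ n) := ⟨fun x => by
      change IsProbabilityMeasure (PMF.toMeasure _); infer_instance⟩

/-- The random actions `I t v` (for rounds `t ≥ 1` and agents `v`) on the probability space
`(Ω, μ)` are produced by running Exp3-Coop: at each round `t`, given the actions of all agents at
rounds `1, …, t - 1`, the agents draw their actions independently, agent `v` from `p_t(·,v)`.
Here `h` ranges over the possible sequences of action profiles; `prob … h t` depends only on the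
profiles of `h` at rounds before `t`. -/
structure IsRun (G : SimpleGraph V) (d : ℕ) (η : ℝ) (ℓ : ℕ → Fin K → ℝ)
    {Ω : Type*} [MeasurableSpace Ω] (μ : Measure Ω) (I : ℕ → V → Ω → Fin K) : Prop where
  measurable : ∀ t v, Measurable (I t v)
  law : ∀ t, 1 ≤ t → ∀ h : ℕ → V → Fin K,
    μ.real {ω | ∀ s ∈ Finset.Icc 1 t, ∀ v, I s v ω = h s v} =
      μ.real {ω | ∀ s ∈ Finset.Ico 1 t, ∀ v, I s v ω = h s v} *
        ∏ v, prob G d η ℓ h t (h t v) v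

/-- Exp3-Coop can be run: a process with the law required by `IsRun` exists. -/
theorem exists_run [NeZero K] [DecidableEq V] (G : SimpleGraph V) (d : ℕ) (η : ℝ) (ℓ : ℕ → Fin K → ℝ) :
    ∃ (μ : Measure (ℕ → V → Fin K)) (_ : IsProbabilityMeasure μ),
      IsRun G d η ℓ μ (fun t v ω => ω t v) := by
  let μ : Measure (ℕ → V → Fin K) :=
    ProbabilityTheory.Kernel.trajMeasure (X := fun _ => V → Fin K) (Measure.dirac 0) (stepKernel G d η ℓ)
  have hp : IsProbabilityMeasure μ := by dsimp only [μ]; infer_instance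
  refine ⟨μ, hp, ⟨fun t v => by fun_prop, ?_⟩⟩
  intro t ht h
  obtain ⟨n, rfl⟩ : ∃ s, t = s + 1 := ⟨t - 1, by omega⟩
  have key := ProbabilityTheory.Kernel.map_frestrictLe_trajMeasure_compProd_eq_map_trajMeasure
    (X := fun _ => V → Fin K) (μ₀ := Measure.dirac 0) (κ := stepKernel G d η ℓ) (a := n)
  let S : Set ((i : Finset.Iic n) → V → Fin K) := {x | ∀ i : Finset.Iic n, 1 ≤ i.1 → x i = h i.1}
  have hS : MeasurableSet S := S.to_countable.measurableSet
  have e1 : {ω : ℕ → V → Fin K | ∀ s ∈ Finset.Icc 1 (n+1), ∀ v, ω s v = h s v} =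
      (fun x => (Preorder.frestrictLe (π := fun _ => V → Fin K) n x, x (n+1))) ⁻¹' (S ×ˢ {h (n+1)}) := by
    ext ω
    simp only [Set.mem_ofPred_eq, Finset.mem_Icc, Set.mem_preimage, Set.mem_prod, S,
      Set.mem_singleton_iff, Preorder.frestrictLe, Finset.restrict, Subtype.forall, Finset.mem_Iic]
    constructor
    · intro H
      exact ⟨fun s hs h1 => funext (H s ⟨h1, by omega⟩), funext (H _ ⟨by omega, le_rfl⟩)⟩
    · rintro ⟨H, H'⟩ s hs v
      rcases Nat.lt_or_ge n s with h1 | h1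
      · obtain rfl : s = n+1 := by omega
        rw [H']
      · rw [H s h1 hs.1]
  have e2 : {ω : ℕ → V → Fin K | ∀ s ∈ Finset.Ico 1 (n+1), ∀ v, ω s v = h s v} =
      Preorder.frestrictLe (π := fun _ => V → Fin K) n ⁻¹' S := by
    ext ω
    simp only [Set.mem_ofPred_eq, Finset.mem_Ico, Set.mem_preimage, S,
      Preorder.frestrictLe, Finset.restrict, Subtype.forall, Finset.mem_Iic]
    constructor
    · intro H s hs h1
      exact funext (H s ⟨h1, by omega⟩)
    · intro H s hs v
      rw [H s (by omega) hs.1]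
  have hv : ∀ x ∈ S, stepKernel G d η ℓ n x {h (n+1)} =
      ENNReal.ofReal (∏ v, prob G d η ℓ h (n+1) (h (n+1) v) v) := by
    intro x hx
    change (PMF.toMeasure _) _ = _
    rw [PMF.toMeasure_apply_singleton _ _ (measurableSet_singleton _)]
    simp only [profilePMF, PMF.ofFintype_apply]
    congr 1
    refine Finset.prod_congr rfl fun v _ => ?_
    unfold prob
    rw [weight_congr G d η ℓ (extend n x) h]
    intro s h1 h2
    have : s ≤ n := by omega
    simp only [extend, this, dif_pos]
    exact hx ⟨s, Finset.mem_Iic.2 this⟩ h1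
  have e3 : μ {ω : ℕ → V → Fin K | ∀ s ∈ Finset.Icc 1 (n+1), ∀ v, ω s v = h s v} =
     ENNReal.ofReal (∏ v, prob G d η ℓ h (n+1) (h (n+1) v) v) *
     μ {ω : ℕ → V → Fin K | ∀ s ∈ Finset.Ico 1 (n+1), ∀ v, ω s v = h s v} := by
    rw [e1, e2, ← Measure.map_apply (by fun_prop) (hS.prod (measurableSet_singleton _)),
      ← Measure.map_apply (by fun_prop) hS]
    dsimp only [μ]
    rw [← key, Measure.compProd_apply_prod hS (measurableSet_singleton _),
      setLIntegral_congr_fun hS hv, setLIntegral_const]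
  rw [measureReal_def, e3, measureReal_def, ENNReal.toReal_mul, mul_comm, ENNReal.toReal_ofReal]
  exact Finset.prod_nonneg fun v _ => (normalize_pos _ (weight_pos G d η ℓ h _) _ _).le

/-- The average welfare regret after `T` rounds,
`(1/N) ∑_v 𝔼[∑_{t ≤ T} ℓ_t(I_t(v))] - min_i ∑_{t ≤ T} ℓ_t(i)`. -/
def regret [NeZero K] (ℓ : ℕ → Fin K → ℝ) {Ω : Type*} [MeasurableSpace Ω] (μ : Measure Ω)
    (I : ℕ → V → Ω → Fin K) (T : ℕ) : ℝ :=
  1 / (Fintype.card V : ℝ) * ∑ v, ∫ ω, ∑ t ∈ Finset.Icc 1 T, ℓ t (I t v ω) ∂μ -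
    Finset.univ.inf' Finset.univ_nonempty fun i : Fin K => ∑ t ∈ Finset.Icc 1 T, ℓ t i

end Exp3Coop

end

/-! ### Exponential weights along a fixed loss sequence -/

namespace Exp3Coop

/-! Each agent runs exponential weights on its own delayed estimates, so along every realization
`hedge_regret` bounds its estimated regret by `ln K / η` plus `η / 2` times a second-moment sum. The
estimate for round `s` is used at round `s + d`, and three facts deal with this lag.

The delay makes `p_{s+d}` a function of the actions before round `s` (`weight_congr_of_delay`).
Hence, conditionally on those actions, the estimate is unbiased even when weighted by `p_{s+d}`
(`integral_mul_lossEst`). Next, replacing `p_s` by `p_{s+d}` in the actual loss costs at most `η d`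
in expectation, since one step lowers `p_t(i)` by at most `η p_t(i)` times the estimate, and these
products have expected sum at most 1 (`integral_sum_mul_prob_sub_le`). Finally, the choice of `η`
keeps one-step ratios of probabilities below `1 + 1/d`, so `p_{s+d} ≤ e p_s` (`prob_add_le`), and
the second moment is at most `e` times the expectation of `p_s / q_s`.

Cooperation enters only when `p_s / q_s` is summed over the agents: `q` is comparable to `min(P,
1)`, with `P` the probability mass of action `i` in the neighbourhood, and a weighted Caro–Wei bound
gives `∑ p / P ≤ α(G_{≤d})` (`sum_div_playedProb_le`). Averaging over agents and inserting `η`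
yields the bound. -/

theorem exp_neg_le_quadratic {x : ℝ} (hx : 0 ≤ x) : Real.exp (-x) ≤ 1 - x + x ^ 2 / 2 := by
  have h1 := Real.quadratic_le_exp_of_nonneg hx
  have h2 : 0 < 1 + x + x ^ 2 / 2 := by positivity
  have h3 : Real.exp (-x) * Real.exp x = 1 := by rw [← Real.exp_add]; simp
  have h4 : Real.exp (-x) * (1 + x + x ^ 2 / 2) ≤ 1 :=
    (mul_le_mul_of_nonneg_left h1 (Real.exp_pos _).le).trans_eq h3
  -- The product equals `1 + x ^ 4 / 4`.
  have h5 : 1 ≤ (1 - x + x ^ 2 / 2) * (1 + x + x ^ 2 / 2) := by nlinarith [sq_nonneg (x ^ 2)]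
  exact le_of_mul_le_mul_right (h4.trans h5) h2

/-- One step of exponential weights, with loss vector `x`, takes `p` to `p'`. -/
structure ExpStep {ι : Type*} [Fintype ι] (η : ℝ) (p x p' : ι → ℝ) : Prop where
  pos : ∀ i, 0 < p i
  sum_eq : ∑ i, p i = 1
  nonneg : ∀ i, 0 ≤ x i
  mul_eq : ∀ i, p' i * ∑ j, p j * Real.exp (-η * x j) = p i * Real.exp (-η * x i)

namespace ExpStep

variable {ι : Type*} [Fintype ι] {η : ℝ} {p x p' : ι → ℝ}

theorem nonempty (h : ExpStep η p x p') : Nonempty ι := by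
  by_contra hn
  rw [not_nonempty_iff] at hn
  simpa using h.sum_eq

theorem partition_pos (h : ExpStep η p x p') : 0 < ∑ j, p j * Real.exp (-η * x j) :=
  have := h.nonempty
  Finset.sum_pos (fun j _ => mul_pos (h.pos j) (Real.exp_pos _)) Finset.univ_nonempty

theorem pos' (h : ExpStep η p x p') (i : ι) : 0 < p' i :=
  pos_of_mul_pos_left (h.mul_eq i ▸ mul_pos (h.pos i) (Real.exp_pos _)) h.partition_pos.le

theorem exp_le_one (h : ExpStep η p x p') (hη : 0 ≤ η) (i : ι) : Real.exp (-η * x i) ≤ 1 :=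
  Real.exp_le_one_iff.2 (by nlinarith [mul_nonneg hη (h.nonneg i)])

theorem partition_le_one (h : ExpStep η p x p') (hη : 0 ≤ η) :
    ∑ j, p j * Real.exp (-η * x j) ≤ 1 := by
  rw [← h.sum_eq]
  exact Finset.sum_le_sum fun j _ => mul_le_of_le_one_right (h.pos j).le (h.exp_le_one hη j)

theorem le_partition (h : ExpStep η p x p') :
    1 - η * ∑ j, p j * x j ≤ ∑ j, p j * Real.exp (-η * x j) := by
  rw [← h.sum_eq, Finset.mul_sum, ← Finset.sum_sub_distrib]
  refine Finset.sum_le_sum fun j _ => ?_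
  nlinarith [mul_le_mul_of_nonneg_left (Real.add_one_le_exp (-η * x j)) (h.pos j).le]

theorem partition_le (h : ExpStep η p x p') (hη : 0 ≤ η) :
    ∑ j, p j * Real.exp (-η * x j) ≤
      1 - η * ∑ j, p j * x j + η ^ 2 / 2 * ∑ j, p j * x j ^ 2 := by
  rw [← h.sum_eq, Finset.mul_sum, Finset.mul_sum, ← Finset.sum_sub_distrib,
    ← Finset.sum_add_distrib]
  refine Finset.sum_le_sum fun j _ => ?_
  have := mul_le_mul_of_nonneg_left (exp_neg_le_quadratic (mul_nonneg hη (h.nonneg j))) (h.pos j).le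
  rw [← neg_mul] at this
  nlinarith

/-- The normalizer is at most 1, so normalizing only raises the weight `p i * exp (-η * x i)`, which
is at least `p i * (1 - η * x i)`. -/
theorem sub_le (h : ExpStep η p x p') (hη : 0 ≤ η) (i : ι) : p i - p' i ≤ η * (p i * x i) := by
  have h1 := mul_le_of_le_one_right (h.pos' i).le (h.partition_le_one hη)
  rw [h.mul_eq] at h1
  nlinarith [mul_le_mul_of_nonneg_left (Real.add_one_le_exp (-η * x i)) (h.pos i).le]

/-- Only the normalizer can make a probability grow, and it is at least `1 - η ∑ p x`. -/
theorem mul_le (h : ExpStep η p x p') (hη : 0 ≤ η) (i : ι) :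
    p' i * (1 - η * ∑ j, p j * x j) ≤ p i := by
  refine (mul_le_mul_of_nonneg_left h.le_partition (h.pos' i).le).trans ?_
  rw [h.mul_eq]
  exact mul_le_of_le_one_right (h.pos i).le (h.exp_le_one hη i)

/-- The increment of `log p k` is exactly `-η x k - log Z`, with `Z` the normalizer; then `log Z ≤ Z
- 1` and the quadratic bound on `Z` apply. -/
theorem potential (h : ExpStep η p x p') (hη : 0 ≤ η) (k : ι) :
    η * (∑ j, p j * x j - x k) - η ^ 2 / 2 * ∑ j, p j * x j ^ 2 ≤
      Real.log (p' k) - Real.log (p k) := by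
  have h1 := congrArg Real.log (h.mul_eq k)
  rw [Real.log_mul (h.pos' k).ne' h.partition_pos.ne',
    Real.log_mul (h.pos k).ne' (Real.exp_pos _).ne', Real.log_exp] at h1
  have h2 := Real.log_le_sub_one_of_pos h.partition_pos
  have h3 := h.partition_le hη
  linarith

end ExpStep

/-- The regret bound of exponential weights. -/
theorem hedge_regret {ι : Type*} [Fintype ι] {η : ℝ} (hη : 0 < η) {p x : ℕ → ι → ℝ}
    (h : ∀ t, 1 ≤ t → ExpStep η (p t) (x t) (p (t + 1))) (M : ℕ) (k : ι) (hk : p (M + 1) k ≤ 1) :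
    ∑ t ∈ Finset.Icc 1 M, (∑ i, p t i * x t i - x t k) ≤
      -Real.log (p 1 k) / η + η / 2 * ∑ t ∈ Finset.Icc 1 M, ∑ i, p t i * x t i ^ 2 := by
  have key : ∀ M : ℕ, η * ∑ t ∈ Finset.Icc 1 M, (∑ i, p t i * x t i - x t k) -
      η ^ 2 / 2 * ∑ t ∈ Finset.Icc 1 M, ∑ i, p t i * x t i ^ 2 ≤
      Real.log (p (M + 1) k) - Real.log (p 1 k) := by
    intro M
    induction M with
    | zero => simp
    | succ n ih =>
      rw [Finset.sum_Icc_succ_top (by omega), Finset.sum_Icc_succ_top (by omega)]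
      have := (h (n + 1) (by omega)).potential hη.le k
      linarith
  have h1 := key M
  have h2 : Real.log (p (M + 1) k) ≤ 0 := Real.log_nonpos ((h (M + 1) (by omega)).pos k).le hk
  rw [div_add' _ _ _ hη.ne', le_div_iff₀ hη]
  nlinarith

/-- This is `(1 + 1/d) ^ d ≤ e`. Clearing the denominator lets the case `d = 0`, where the
hypothesis is empty, be included. -/
theorem iterate_ratio_le {d : ℕ} {u : ℕ → ℝ} (hu : 0 ≤ u 0)
    (h : ∀ n < d, d * u (n + 1) ≤ (d + 1) * u n) : u d ≤ Real.exp 1 * u 0 := by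
  rcases Nat.eq_zero_or_pos d with rfl | hd
  · have := Real.add_one_le_exp (1 : ℝ)
    nlinarith
  have hd' : (0 : ℝ) < d := by exact_mod_cast hd
  have key : ∀ n ≤ d, u n ≤ (1 + 1 / (d : ℝ)) ^ n * u 0 := by
    intro n
    induction n with
    | zero => simp
    | succ n ih =>
      intro hn
      have h1 := h n (by omega)
      have h2 : u (n + 1) ≤ (1 + 1 / (d : ℝ)) * u n := by
        rw [one_add_div hd'.ne', div_mul_eq_mul_div, le_div_iff₀ hd']
        linarith
      refine h2.trans ?_
      rw [pow_succ', mul_assoc]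
      exact mul_le_mul_of_nonneg_left (ih (by omega)) (by positivity)
  refine (key d le_rfl).trans (mul_le_mul_of_nonneg_right ?_ hu)
  calc (1 + 1 / (d : ℝ)) ^ d ≤ Real.exp (1 / d) ^ d :=
        pow_le_pow_left₀ (by positivity) (by linarith [Real.add_one_le_exp (1 / (d : ℝ))]) d
    _ = Real.exp 1 := by rw [← Real.exp_nat_mul]; congr 1; field_simp

/-! ### Pathwise properties of Exp3-Coop -/

variable {V : Type*} [Fintype V] {K : ℕ} (G : SimpleGraph V) (d : ℕ) (η : ℝ)
  (ℓ : ℕ → Fin K → ℝ) (I : ℕ → V → Fin K)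

/-- The weights at round `t` depend only on the actions at rounds before `t - d`. -/
theorem weight_congr_of_delay (I J : ℕ → V → Fin K) (t : ℕ)
    (h : ∀ s, 1 ≤ s → s + d < t → I s = J s) : weight G d η ℓ I t = weight G d η ℓ J t := by
  induction t using Nat.strong_induction_on with
  | _ t ih =>
    match t with
    | 0 => simp [weight]
    | 1 => simp [weight]
    | s + 2 =>
      funext i v
      rw [weight, weight]
      rw [ih (s+1) (by omega) (fun r h1 h2 => h r h1 (by omega))]
      split_ifs with hd
      · rw [ih (s+1-d) (by omega) (fun r h1 h2 => h r h1 (by omega)),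
          h (s+1-d) (by omega) (by omega)]
      · rfl

theorem prob_congr_of_delay (I J : ℕ → V → Fin K) (t : ℕ)
    (h : ∀ s, 1 ≤ s → s + d < t → I s = J s) : prob G d η ℓ I t = prob G d η ℓ J t := by
  funext i v
  rw [prob, prob, weight_congr_of_delay G d η ℓ I J t h]

theorem mem_nbhd {G : SimpleGraph V} {d : ℕ} {u v : V} : u ∈ nbhd G d v ↔ G.edist v u ≤ d := by
  simp [nbhd]

theorem self_mem_nbhd (v : V) : v ∈ nbhd G d v := by
  simp [mem_nbhd]

theorem le_playedProb {p : Fin K → V → ℝ} (h0 : ∀ i v, 0 ≤ p i v) (h1 : ∀ i v, p i v ≤ 1)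
    (i : Fin K) (v : V) : p i v ≤ playedProb G d p i v := by
  classical
  rw [playedProb, ← Finset.mul_prod_erase _ _ (self_mem_nbhd G d v)]
  have : ∏ u ∈ (nbhd G d v).erase v, (1 - p i u) ≤ 1 :=
    Finset.prod_le_one (fun u _ => sub_nonneg.2 (h1 i u)) fun u _ => by linarith [h0 i u]
  nlinarith [mul_le_mul_of_nonneg_left this (sub_nonneg.2 (h1 i v))]

theorem playedInd_nonneg (a : V → Fin K) (i : Fin K) (v : V) : 0 ≤ playedInd G d a i v := by
  unfold playedInd; split_ifs <;> norm_num

theorem playedInd_le_one (a : V → Fin K) (i : Fin K) (v : V) : playedInd G d a i v ≤ 1 := by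
  unfold playedInd; split_ifs <;> norm_num

theorem playedInd_sq (a : V → Fin K) (i : Fin K) (v : V) :
    playedInd G d a i v ^ 2 = playedInd G d a i v := by
  unfold playedInd; split_ifs <;> norm_num

theorem lossEst_add (s : ℕ) (hs : 1 ≤ s) (i : Fin K) (v : V) :
    lossEst G d η ℓ I (s + d) i v =
      ℓ s i / playedProb G d (prob G d η ℓ I s) i v * playedInd G d (I s) i v := by
  rw [lossEst, if_pos (by omega), Nat.add_sub_cancel]

theorem lossEst_of_le {t : ℕ} (ht : t ≤ d) (i : Fin K) (v : V) : lossEst G d η ℓ I t i v = 0 := by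
  rw [lossEst, if_neg (by omega)]

section

variable [NeZero K]

theorem prob_pos (t : ℕ) (i : Fin K) (v : V) : 0 < prob G d η ℓ I t i v :=
  normalize_pos _ (weight_pos G d η ℓ I t) i v

theorem prob_le_one (t : ℕ) (i : Fin K) (v : V) : prob G d η ℓ I t i v ≤ 1 := by
  rw [← sum_prob G d η ℓ I t v]
  exact Finset.single_le_sum (f := fun i => prob G d η ℓ I t i v)
    (fun j _ => (prob_pos G d η ℓ I t j v).le) (Finset.mem_univ i)

omit [NeZero K] in
theorem prob_one (i : Fin K) (v : V) : prob G d η ℓ I 1 i v = (K : ℝ)⁻¹ := by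
  simp [prob, normalize, weight_one]

theorem prob_le_playedProb (t : ℕ) (i : Fin K) (v : V) :
    prob G d η ℓ I t i v ≤ playedProb G d (prob G d η ℓ I t) i v :=
  le_playedProb G d (fun i v => (prob_pos G d η ℓ I t i v).le) (prob_le_one G d η ℓ I t) i v

theorem playedProb_prob_pos (t : ℕ) (i : Fin K) (v : V) :
    0 < playedProb G d (prob G d η ℓ I t) i v :=
  (prob_pos G d η ℓ I t i v).trans_le (prob_le_playedProb G d η ℓ I t i v)

variable {ℓ}

theorem lossEst_nonneg (hℓ : ∀ t, 1 ≤ t → ∀ i, ℓ t i ∈ Set.Icc (0 : ℝ) 1) (t : ℕ) (i : Fin K)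
    (v : V) : 0 ≤ lossEst G d η ℓ I t i v := by
  unfold lossEst
  split_ifs with h
  · exact mul_nonneg (div_nonneg (hℓ _ (by omega) i).1 (playedProb_prob_pos G d η ℓ I _ i v).le)
      (playedInd_nonneg G d _ i v)
  · exact le_rfl

theorem expStep_prob (hℓ : ∀ t, 1 ≤ t → ∀ i, ℓ t i ∈ Set.Icc (0 : ℝ) 1) {t : ℕ} (ht : 1 ≤ t)
    (v : V) : ExpStep η (fun i => prob G d η ℓ I t i v) (fun i => lossEst G d η ℓ I t i v)
      (fun i => prob G d η ℓ I (t + 1) i v) where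
  pos i := prob_pos G d η ℓ I t i v
  sum_eq := sum_prob G d η ℓ I t v
  nonneg i := lossEst_nonneg G d η I hℓ t i v
  mul_eq i := by
    rw [prob, normalize]
    simp only [weight_succ G d η ℓ I ht]
    exact div_mul_cancel₀ _ (Finset.sum_pos (fun j _ => mul_pos (prob_pos G d η ℓ I t j v)
      (Real.exp_pos _)) Finset.univ_nonempty).ne'

variable {η}

/-- The distributions change slowly. -/
theorem prob_succ_le (hη : 0 ≤ η) (hη' : η * (K * Real.exp 1 * (d + 1)) ≤ 1)
    (hℓ : ∀ t, 1 ≤ t → ∀ i, ℓ t i ∈ Set.Icc (0 : ℝ) 1) {t : ℕ} (ht : 1 ≤ t) (i : Fin K) (v : V) :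
    d * prob G d η ℓ I (t + 1) i v ≤ (d + 1) * prob G d η ℓ I t i v := by
  induction t using Nat.strong_induction_on generalizing i with
  | _ t ih =>
    have hstep := (expStep_prob G d η I hℓ ht v).mul_le hη i
    -- Each term is at most `e`: the estimate is at most `1 / q_s ≤ 1 / p_s` with `s = t - d`, and
    -- `p_t ≤ e p_s` follows from the ratio bound at the `d` preceding rounds. This is why the
    -- induction is strong and covers all actions at once.
    have hsum : ∑ j, prob G d η ℓ I t j v * lossEst G d η ℓ I t j v ≤ K * Real.exp 1 := by
      rcases Nat.lt_or_ge d t with hdt | hdt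
      · obtain ⟨s, rfl⟩ : ∃ s, t = s + d := ⟨t - d, by omega⟩
        have hs : 1 ≤ s := by omega
        have hterm : ∀ j ∈ Finset.univ,
            prob G d η ℓ I (s + d) j v * lossEst G d η ℓ I (s + d) j v ≤ Real.exp 1 := by
          intro j _
          have h1 : prob G d η ℓ I (s + d) j v ≤ Real.exp 1 * prob G d η ℓ I s j v :=
            iterate_ratio_le (u := fun n => prob G d η ℓ I (s + n) j v)
              (prob_pos G d η ℓ I s j v).le fun n hn => ih (s + n) (by omega) (by omega) j
          have hq := playedProb_prob_pos G d η ℓ I s j v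
          have h2 : lossEst G d η ℓ I (s + d) j v ≤ 1 / prob G d η ℓ I s j v := by
            rw [lossEst_add G d η ℓ I s hs]
            refine (mul_le_of_le_one_right (div_nonneg (hℓ s hs j).1 hq.le)
              (playedInd_le_one G d _ j v)).trans ?_
            exact div_le_div₀ zero_le_one (hℓ s hs j).2 (prob_pos G d η ℓ I s j v)
              (prob_le_playedProb G d η ℓ I s j v)
          calc _ ≤ Real.exp 1 * prob G d η ℓ I s j v * (1 / prob G d η ℓ I s j v) :=
                mul_le_mul h1 h2 (lossEst_nonneg G d η I hℓ _ j v)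
                  (mul_nonneg (Real.exp_pos _).le (prob_pos G d η ℓ I s j v).le)
            _ = Real.exp 1 := by
                rw [mul_assoc, mul_one_div_cancel (prob_pos G d η ℓ I s j v).ne', mul_one]
        simpa using Finset.sum_le_card_nsmul _ _ _ hterm
      · simp only [lossEst_of_le G d η ℓ I hdt, mul_zero, Finset.sum_const_zero]
        positivity
    -- With `η K e ≤ 1 / (d + 1)`, the factor `1 - η ∑ p x` is at least `d / (d + 1)`.
    have h1 : (d : ℝ) ≤ (d + 1) * (1 - η * ∑ j, prob G d η ℓ I t j v * lossEst G d η ℓ I t j v) := by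
      have h2 := mul_le_mul_of_nonneg_left hsum
        (mul_nonneg hη (by positivity : (0 : ℝ) ≤ d + 1))
      linarith
    calc d * prob G d η ℓ I (t + 1) i v ≤ _ :=
          mul_le_mul_of_nonneg_right h1 (prob_pos G d η ℓ I (t + 1) i v).le
      _ = (d + 1) * (prob G d η ℓ I (t + 1) i v *
            (1 - η * ∑ j, prob G d η ℓ I t j v * lossEst G d η ℓ I t j v)) := by ring
      _ ≤ _ := mul_le_mul_of_nonneg_left hstep (by positivity)

theorem prob_add_le (hη : 0 ≤ η) (hη' : η * (K * Real.exp 1 * (d + 1)) ≤ 1)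
    (hℓ : ∀ t, 1 ≤ t → ∀ i, ℓ t i ∈ Set.Icc (0 : ℝ) 1) {s : ℕ} (hs : 1 ≤ s) (i : Fin K) (v : V) :
    prob G d η ℓ I (s + d) i v ≤ Real.exp 1 * prob G d η ℓ I s i v :=
  iterate_ratio_le (u := fun n => prob G d η ℓ I (s + n) i v) (prob_pos G d η ℓ I s i v).le
    fun n _ => prob_succ_le G d I hη hη' hℓ (t := s + n) (by omega) i v

/-- The loss of playing from the distribution of `d` rounds before. -/
theorem sum_mul_prob_sub_le (hη : 0 ≤ η) (hℓ : ∀ t, 1 ≤ t → ∀ i, ℓ t i ∈ Set.Icc (0 : ℝ) 1)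
    {s : ℕ} (hs : 1 ≤ s) (v : V) (n : ℕ) :
    ∑ i, prob G d η ℓ I s i v * ℓ s i - ∑ i, prob G d η ℓ I (s + n) i v * ℓ s i ≤
      η * ∑ m ∈ Finset.range n,
        ∑ i, prob G d η ℓ I (s + m) i v * lossEst G d η ℓ I (s + m) i v := by
  induction n with
  | zero => simp
  | succ n ih =>
    rw [Finset.sum_range_succ, mul_add]
    have h : ∑ i, prob G d η ℓ I (s + n) i v * ℓ s i -
        ∑ i, prob G d η ℓ I (s + (n + 1)) i v * ℓ s i ≤
        η * ∑ i, prob G d η ℓ I (s + n) i v * lossEst G d η ℓ I (s + n) i v := by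
      rw [← Finset.sum_sub_distrib, Finset.mul_sum]
      refine Finset.sum_le_sum fun i _ => ?_
      rw [← sub_mul]
      have h1 := (expStep_prob G d η I hℓ (t := s + n) (by omega) v).sub_le hη i
      have h2 : 0 ≤ η * (prob G d η ℓ I (s + n) i v * lossEst G d η ℓ I (s + n) i v) :=
        mul_nonneg hη (mul_nonneg (prob_pos G d η ℓ I _ i v).le (lossEst_nonneg G d η I hℓ _ i v))
      exact (mul_le_mul_of_nonneg_right h1 (hℓ s hs i).1).trans
        (mul_le_of_le_one_right h2 (hℓ s hs i).2)
    linarith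

theorem sum_lossEst_regret_le (hη : 0 < η) (hℓ : ∀ t, 1 ≤ t → ∀ i, ℓ t i ∈ Set.Icc (0 : ℝ) 1)
    (v : V) (k : Fin K) (T : ℕ) :
    ∑ s ∈ Finset.Icc 1 T, (∑ i, prob G d η ℓ I (s + d) i v * lossEst G d η ℓ I (s + d) i v -
        lossEst G d η ℓ I (s + d) k v) ≤
      Real.log K / η + η / 2 * ∑ s ∈ Finset.Icc 1 T,
        ∑ i, prob G d η ℓ I (s + d) i v * lossEst G d η ℓ I (s + d) i v ^ 2 := by
  -- Hedge runs for `T + d` rounds, so that the losses of all rounds up to `T` have been reported;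
  -- its first `d` rounds contribute nothing.
  have h := hedge_regret hη (p := fun t i => prob G d η ℓ I t i v)
    (x := fun t i => lossEst G d η ℓ I t i v) (fun t ht => expStep_prob G d η I hℓ ht v) (T + d) k
    (prob_le_one G d η ℓ I _ k v)
  have shift : ∀ f : ℕ → ℝ, (∀ t ≤ d, f t = 0) →
      ∑ t ∈ Finset.Icc 1 (T + d), f t = ∑ s ∈ Finset.Icc 1 T, f (s + d) := by
    intro f hf
    refine Eq.trans ?_ (Finset.sum_map (Finset.Icc 1 T) (addRightEmbedding d) f)
    rw [Finset.map_add_right_Icc]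
    symm
    refine Finset.sum_subset (Finset.Icc_subset_Icc (by omega) le_rfl) fun t h1 h2 => hf t ?_
    simp only [Finset.mem_Icc] at h1 h2
    omega
  rw [shift _ (fun t ht => by simp [lossEst_of_le G d η ℓ I ht]),
    shift _ (fun t ht => by simp [lossEst_of_le G d η ℓ I ht]), prob_one, Real.log_inv, neg_neg] at h
  exact h

end

end Exp3Coop

/-! ### Graph-theoretic bound on the second-moment factors -/

namespace Exp3Coop

variable {V : Type*} [Fintype V] {K : ℕ} (G : SimpleGraph V) (d : ℕ)

/-- A weighted form of the Caro–Wei bound, by greedy choice of an independent set. -/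
theorem sum_div_sum_nbhd_le_indepNum {p : V → ℝ} (hp : ∀ v, 0 < p v) :
    ∑ v, p v / ∑ u ∈ nbhd G d v, p u ≤ (graphPower G d).indepNum := by
  classical
  have hP : ∀ v, 0 < ∑ u ∈ nbhd G d v, p u := fun v =>
    Finset.sum_pos (fun u _ => hp u) ⟨v, self_mem_nbhd G d v⟩
  -- The denominators keep the masses of full neighbourhoods as `S` shrinks, so the remaining terms
  -- do not change.
  have key : ∀ S : Finset V, ∃ A ⊆ S, (graphPower G d).IsIndepSet (A : Set V) ∧
      ∑ v ∈ S, p v / ∑ u ∈ nbhd G d v, p u ≤ A.card := by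
    intro S
    induction S using Finset.strongInductionOn with
    | _ S ih =>
      rcases S.eq_empty_or_nonempty with rfl | hS
      · exact ⟨∅, subset_rfl, by simp [SimpleGraph.IsIndepSet], by simp⟩
      -- By minimality of the mass around `v`, the terms deleted together with `v` sum to at most 1,
      -- which the new vertex `v` pays for.
      obtain ⟨v, hv, hmin⟩ := S.exists_min_image (fun v => ∑ u ∈ nbhd G d v, p u) hS
      have hv' : v ∉ S \ nbhd G d v := fun h => (Finset.mem_sdiff.1 h).2 (self_mem_nbhd G d v)
      obtain ⟨A, hAS, hA, hle⟩ := ih (S \ nbhd G d v)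
        ⟨Finset.sdiff_subset, fun h => hv' (h hv)⟩
      have hvA : v ∉ A := fun h => hv' (hAS h)
      refine ⟨insert v A, Finset.insert_subset hv (hAS.trans Finset.sdiff_subset), ?_, ?_⟩
      · rw [Finset.coe_insert, SimpleGraph.IsIndepSet, Set.pairwise_insert]
        have hnadj : ∀ u ∈ A, ¬ (graphPower G d).Adj v u := fun u hu h =>
          (Finset.mem_sdiff.1 (hAS hu)).2 (mem_nbhd.2 h.2)
        exact ⟨hA, fun u hu _ => ⟨hnadj u hu, fun h => hnadj u hu h.symm⟩⟩
      · have h1 : ∑ w ∈ S ∩ nbhd G d v, p w / ∑ u ∈ nbhd G d w, p u ≤ 1 := by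
          calc _ ≤ ∑ w ∈ S ∩ nbhd G d v, p w / ∑ u ∈ nbhd G d v, p u :=
                Finset.sum_le_sum fun w hw => div_le_div_of_nonneg_left (hp w).le (hP v)
                  (hmin w (Finset.mem_inter.1 hw).1)
            _ = (∑ w ∈ S ∩ nbhd G d v, p w) / ∑ u ∈ nbhd G d v, p u := by rw [Finset.sum_div]
            _ ≤ 1 := (div_le_one (hP v)).2 (Finset.sum_le_sum_of_subset_of_nonneg
                Finset.inter_subset_right fun u _ _ => (hp u).le)
        rw [← Finset.sum_inter_add_sum_sdiff S (nbhd G d v), Finset.card_insert_of_notMem hvA]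
        push_cast
        linarith
  obtain ⟨A, -, hA, hle⟩ := key Finset.univ
  exact hle.trans (by exact_mod_cast hA.card_le_indepNum)

theorem one_sub_exp_neg_one_pos : 0 < 1 - Real.exp (-1) :=
  sub_pos.2 (Real.exp_lt_one_iff.2 (by norm_num))

/-- On `[0, 1]` the concave function `1 - exp (-x)` lies above its chord; beyond 1 it is monotone.
-/
theorem mul_min_le_one_sub_exp_neg {x : ℝ} (hx : 0 ≤ x) :
    (1 - Real.exp (-1)) * min x 1 ≤ 1 - Real.exp (-x) := by
  rcases le_total x 1 with h | h
  · rw [min_eq_left h]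
    have := convexOn_exp.2 (Set.mem_univ (0 : ℝ)) (Set.mem_univ (-1 : ℝ)) (sub_nonneg.2 h) hx
      (by ring)
    simp only [smul_eq_mul, mul_zero, zero_add, mul_neg, mul_one, Real.exp_zero] at this
    linarith
  · rw [min_eq_right h, mul_one]
    have := Real.exp_le_exp.2 (neg_le_neg h)
    linarith

/-- The sum over all agents of the second-moment factors. -/
theorem sum_div_playedProb_le {p : Fin K → V → ℝ} (h0 : ∀ i v, 0 < p i v) (h1 : ∀ i v, p i v ≤ 1)
    (i : Fin K) :
    ∑ v, p i v / playedProb G d p i v ≤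
      ((graphPower G d).indepNum + ∑ v, p i v) / (1 - Real.exp (-1)) := by
  refine le_trans ?_ (div_le_div_of_nonneg_right (add_le_add_left
    (sum_div_sum_nbhd_le_indepNum G d (h0 i)) _) one_sub_exp_neg_one_pos.le)
  rw [← Finset.sum_add_distrib, Finset.sum_div]
  refine Finset.sum_le_sum fun v _ => ?_
  set P := ∑ u ∈ nbhd G d v, p i u with hPdef
  have hP : 0 < P := Finset.sum_pos (fun u _ => h0 i u) ⟨v, self_mem_nbhd G d v⟩
  have hq : (1 - Real.exp (-1)) * min P 1 ≤ playedProb G d p i v := by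
    refine (mul_min_le_one_sub_exp_neg hP.le).trans (sub_le_sub_left ?_ 1)
    rw [hPdef, ← Finset.sum_neg_distrib, Real.exp_sum]
    exact Finset.prod_le_prod (fun u _ => sub_nonneg.2 (h1 i u)) fun u _ =>
      Real.one_sub_le_exp_neg _
  have hm : 0 < min P 1 := lt_min hP one_pos
  calc p i v / playedProb G d p i v ≤ p i v / ((1 - Real.exp (-1)) * min P 1) :=
        div_le_div_of_nonneg_left (h0 i v).le (mul_pos one_sub_exp_neg_one_pos hm) hq
    _ = p i v / min P 1 / (1 - Real.exp (-1)) := by rw [mul_comm, div_div]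
    _ ≤ _ := by
        refine div_le_div_of_nonneg_right ?_ one_sub_exp_neg_one_pos.le
        -- This is `1 / min P 1 ≤ 1 / P + 1`, multiplied by `p i v`.
        rcases le_total P 1 with h | h
        · rw [min_eq_left h]; linarith [h0 i v]
        · rw [min_eq_right h, div_one]; linarith [div_pos (h0 i v) hP]

end Exp3Coop

/-! ### Conditioning on the past as finite sums -/

namespace Exp3Coop

/-- Finitely many rounds have finitely many outcomes, so expectations are finite sums and no
conditional expectation operator is needed. -/
theorem integral_comp_eq_sum {Ω α : Type*} [MeasurableSpace Ω] {μ : Measure Ω} [IsFiniteMeasure μ]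
    [Fintype α] [MeasurableSpace α] [MeasurableSingletonClass α] {X : Ω → α} (hX : Measurable X)
    (φ : α → ℝ) : ∫ ω, φ (X ω) ∂μ = ∑ x, μ.real (X ⁻¹' {x}) * φ x := by
  rw [← integral_map hX.aemeasurable (Integrable.of_finite (μ := μ.map X)).aestronglyMeasurable,
    integral_fintype Integrable.of_finite]
  simp [map_measureReal_apply hX (measurableSet_singleton _)]

variable {V : Type*} [Fintype V] {K : ℕ}

/-- The action profiles of all rounds. -/
def history {Ω : Type*} (I : ℕ → V → Ω → Fin K) (ω : Ω) : ℕ → V → Fin K := fun t v => I t v ω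

/-- The action profiles of the rounds before `t`. -/
def past {Ω : Type*} (I : ℕ → V → Ω → Fin K) (t : ℕ) (ω : Ω) : Finset.Ico 1 t → V → Fin K :=
  fun s => history I ω s

/-- Extends action profiles of the rounds before `t` to all rounds. -/
def extendPast [NeZero K] (t : ℕ) (z : Finset.Ico 1 t → V → Fin K) : ℕ → V → Fin K :=
  fun s => if h : s ∈ Finset.Ico 1 t then z ⟨s, h⟩ else 0

omit [Fintype V] in
theorem extendPast_past [NeZero K] {Ω : Type*} (I : ℕ → V → Ω → Fin K) (t : ℕ) (ω : Ω) {s : ℕ}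
    (hs : s ∈ Set.Ico 1 t) : extendPast t (past I t ω) s = history I ω s := by
  rw [extendPast, dif_pos (Finset.mem_Ico.2 hs), past]

omit [Fintype V] in
theorem apply_extendPast [NeZero K] {Ω : Type*} (I : ℕ → V → Ω → Fin K) {t : ℕ} (ω : Ω)
    {f : (ℕ → V → Fin K) → ℝ} (hf : DependsOn f (Set.Ico 1 t)) :
    f (extendPast t (past I t ω)) = f (history I ω) :=
  hf fun _ hs => extendPast_past I t ω hs

namespace IsRun

variable [NeZero K] {G : SimpleGraph V} {d : ℕ} {η : ℝ} {ℓ : ℕ → Fin K → ℝ}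
  {Ω : Type*} [MeasurableSpace Ω] {μ : Measure Ω} {I : ℕ → V → Ω → Fin K}

omit [NeZero K] in
theorem measurable_past (hI : IsRun G d η ℓ μ I) (t : ℕ) : Measurable (past I t) :=
  measurable_pi_lambda _ fun s => measurable_pi_lambda _ fun v => hI.measurable s v

theorem integrable [IsFiniteMeasure μ] (hI : IsRun G d η ℓ μ I) {t : ℕ}
    {f : (ℕ → V → Fin K) → ℝ} (hf : DependsOn f (Set.Ico 1 t)) :
    Integrable (fun ω => f (history I ω)) μ := by
  simp_rw [← fun ω => apply_extendPast I ω hf]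
  exact (Integrable.of_finite (μ := μ.map (past I t))
    (f := fun z => f (extendPast t z))).comp_measurable (hI.measurable_past t)

/-- The actions of round `t` may be averaged out given the past. -/
theorem integral_step [DecidableEq V] [IsFiniteMeasure μ] (hI : IsRun G d η ℓ μ I) {t : ℕ}
    (ht : 1 ≤ t) {f : (V → Fin K) → (ℕ → V → Fin K) → ℝ}
    (hf : ∀ a, DependsOn (f a) (Set.Ico 1 t)) :
    ∫ ω, f (history I ω t) (history I ω) ∂μ =
      ∫ ω, ∑ a, (∏ v, prob G d η ℓ (history I ω) t (a v) v) * f a (history I ω) ∂μ := by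
  have hprob : ∀ h h' : ℕ → V → Fin K, (∀ s ∈ Set.Ico 1 t, h s = h' s) →
      prob G d η ℓ h t = prob G d η ℓ h' t := fun h h' hh =>
    prob_congr_of_delay G d η ℓ h h' t fun s h1 h2 => hh s ⟨h1, by omega⟩
  have hdep : DependsOn (fun h => ∑ a, (∏ v, prob G d η ℓ h t (a v) v) * f a h)
      (Set.Ico 1 t) := fun h h' hh => by
    simp only [hprob h h' hh, fun a => hf a hh]
  have hpair : Measurable fun ω => (past I t ω, history I ω t) :=
    (hI.measurable_past t).prodMk (measurable_pi_lambda _ fun v => hI.measurable t v)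
  have hlaw : ∀ z b, μ.real ((fun ω => (past I t ω, history I ω t)) ⁻¹' {(z, b)}) =
      μ.real (past I t ⁻¹' {z}) * ∏ v, prob G d η ℓ (extendPast t z) t (b v) v := by
    intro z b
    have hlt : ∀ s ∈ Finset.Ico 1 t, Function.update (extendPast t z) t b s = extendPast t z s :=
      fun s hs => Function.update_of_ne (Finset.mem_Ico.1 hs).2.ne _ _
    have hpast : ∀ ω, past I t ω = z ↔ ∀ s ∈ Finset.Ico 1 t, ∀ v,
        I s v ω = Function.update (extendPast t z) t b s v := by
      intro ω
      constructor
      · rintro rfl s hs v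
        rw [hlt s hs, extendPast_past I t ω (Finset.mem_Ico.1 hs), history]
      · intro h
        funext s v
        have := h s s.2 v
        rw [hlt s s.2, extendPast, dif_pos s.2] at this
        exact this
    -- The law is read along the past `z` followed by the profile `b` at round `t`; later rounds are
    -- irrelevant.
    have h := hI.law t ht (Function.update (extendPast t z) t b)
    rw [hprob _ (extendPast t z) fun s hs => hlt s (Finset.mem_Ico.2 hs), Function.update_self] at h
    have e1 : (fun ω => (past I t ω, history I ω t)) ⁻¹' {(z, b)} =
        {ω | ∀ s ∈ Finset.Icc 1 t, ∀ v, I s v ω = Function.update (extendPast t z) t b s v} := by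
      ext ω
      simp only [Set.mem_preimage, Set.mem_singleton_iff, Prod.mk.injEq, Set.mem_ofPred_eq, hpast]
      constructor
      · rintro ⟨h1, h2⟩ s hs v
        rcases (Finset.mem_Icc.1 hs).2.eq_or_lt with rfl | h3
        · rw [Function.update_self, ← h2, history]
        · exact h1 s (Finset.mem_Ico.2 ⟨(Finset.mem_Icc.1 hs).1, h3⟩) v
      · intro h
        refine ⟨fun s hs => h s (Finset.Ico_subset_Icc_self hs), funext fun v => ?_⟩
        have := h t (Finset.mem_Icc.2 ⟨ht, le_rfl⟩) v
        rwa [Function.update_self] at this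
    have e2 : past I t ⁻¹' {z} =
        {ω | ∀ s ∈ Finset.Ico 1 t, ∀ v, I s v ω = Function.update (extendPast t z) t b s v} :=
      Set.ext hpast
    rw [e1, e2, h]
  simp_rw [← fun ω => apply_extendPast I ω hdep, ← fun a ω => apply_extendPast I ω (hf a)]
  rw [integral_comp_eq_sum hpair fun x => f x.2 (extendPast t x.1),
    integral_comp_eq_sum (hI.measurable_past t) fun z =>
      ∑ a, (∏ v, prob G d η ℓ (extendPast t z) t (a v) v) * f a (extendPast t z),
    Fintype.sum_prod_type]
  simp only [hlaw, Finset.mul_sum, mul_assoc]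

end IsRun

/-- The expectation of a product of functions of independent actions. -/
theorem sum_prod_mul_prod [DecidableEq V] {p : Fin K → V → ℝ} (g : V → Fin K → ℝ) :
    ∑ a : V → Fin K, (∏ v, p (a v) v) * ∏ v, g v (a v) = ∏ v, ∑ i, p i v * g v i := by
  rw [Fintype.prod_sum]
  simp only [Finset.prod_mul_distrib]

theorem sum_prod_mul_apply [DecidableEq V] {p : Fin K → V → ℝ} (hp : ∀ v, ∑ i, p i v = 1)
    (c : Fin K → ℝ) (v : V) :
    ∑ a : V → Fin K, (∏ u, p (a u) u) * c (a v) = ∑ i, p i v * c i := by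
  have h := sum_prod_mul_prod (p := p) fun u i => if u = v then c i else 1
  simp only [Finset.prod_ite_eq', Finset.mem_univ, if_true] at h
  rw [h, Finset.prod_eq_single v]
  · simp
  · intro u _ hu
    simp [hu, hp]
  · simp

/-- The complementary indicator is a product of one factor per agent, so its expectation factorizes
by independence. -/
theorem sum_prod_mul_playedInd [DecidableEq V] (G : SimpleGraph V) (d : ℕ) {p : Fin K → V → ℝ}
    (hp : ∀ v, ∑ i, p i v = 1) (i : Fin K) (v : V) :
    ∑ a : V → Fin K, (∏ u, p (a u) u) * playedInd G d a i v = playedProb G d p i v := by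
  have h := sum_prod_mul_prod (p := p) fun u j => if u ∈ nbhd G d v ∧ j = i then 0 else 1
  have hind : ∀ a : V → Fin K, playedInd G d a i v =
      1 - ∏ u, if u ∈ nbhd G d v ∧ a u = i then (0 : ℝ) else 1 := by
    intro a
    unfold playedInd
    split_ifs with ha
    · obtain ⟨u, hu⟩ := ha
      have h0 : ∏ u, (if u ∈ nbhd G d v ∧ a u = i then (0 : ℝ) else 1) = 0 :=
        Finset.prod_eq_zero (Finset.mem_univ u) (if_pos hu)
      rw [h0, sub_zero]
    · push Not at ha
      rw [Finset.prod_eq_one fun u _ => if_neg fun hu => ha u hu.1 hu.2, sub_self]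
  have h1 : ∑ a : V → Fin K, ∏ u, p (a u) u = 1 := by
    rw [← Fintype.prod_sum fun u j => p j u]
    simp [hp]
  simp only [hind, mul_sub, mul_one, Finset.sum_sub_distrib, h, h1, playedProb]
  congr 1
  rw [← Finset.prod_subset (Finset.subset_univ (nbhd G d v))]
  · refine Finset.prod_congr rfl fun u hu => ?_
    have h2 : ∀ j, p j u * (if u ∈ nbhd G d v ∧ j = i then 0 else 1) =
        p j u - if j = i then p j u else 0 := fun j => by
      by_cases hj : j = i <;> simp [hu, hj]
    simp [h2, hp]
  · intro u _ hu
    simp [hu, hp]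

end Exp3Coop

/-! ### Expected regret of the agents -/

namespace Exp3Coop

variable {V : Type*} [Fintype V] {K : ℕ} {G : SimpleGraph V} {d : ℕ} {η : ℝ}
  {ℓ : ℕ → Fin K → ℝ}

theorem prob_congr_of_Ico {h h' : ℕ → V → Fin K} {s t : ℕ} (hst : t ≤ s + d)
    (hh : ∀ r ∈ Set.Ico 1 s, h r = h' r) : prob G d η ℓ h t = prob G d η ℓ h' t :=
  prob_congr_of_delay G d η ℓ h h' t fun r h1 h2 => hh r ⟨h1, by omega⟩

theorem lossEst_congr_of_Ico {h h' : ℕ → V → Fin K} {t : ℕ}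
    (hh : ∀ r ∈ Set.Ico 1 (t + 1), h r = h' r) : lossEst G d η ℓ h t = lossEst G d η ℓ h' t := by
  funext i v
  unfold lossEst
  split_ifs with hd
  · rw [prob_congr_of_Ico (s := t + 1) (by omega) hh, hh (t - d) ⟨by omega, by omega⟩]
  · rfl

namespace IsRun

variable [NeZero K] {Ω : Type*} [MeasurableSpace Ω] {μ : Measure Ω} [IsProbabilityMeasure μ]
  {I : ℕ → V → Ω → Fin K}

theorem integrable_prob_mul (hI : IsRun G d η ℓ μ I) (t : ℕ) (v : V) (c : Fin K → ℝ) :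
    Integrable (fun ω => ∑ i, prob G d η ℓ (history I ω) t i v * c i) μ :=
  hI.integrable (t := t) (f := fun h => ∑ i, prob G d η ℓ h t i v * c i) fun h h' hh => by
    simp only [prob_congr_of_Ico (G := G) (η := η) (ℓ := ℓ) (Nat.le_add_right t d) hh]

theorem integrable_lossEst (hI : IsRun G d η ℓ μ I) (t : ℕ) (k : Fin K) (v : V) :
    Integrable (fun ω => lossEst G d η ℓ (history I ω) t k v) μ :=
  hI.integrable (t := t + 1) (f := fun h => lossEst G d η ℓ h t k v) fun h h' hh => by
    simp only [lossEst_congr_of_Ico (G := G) (d := d) (η := η) (ℓ := ℓ) hh]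

theorem integrable_prob_mul_lossEst_pow (hI : IsRun G d η ℓ μ I) (t n : ℕ) (i : Fin K) (v : V) :
    Integrable (fun ω => prob G d η ℓ (history I ω) t i v *
      lossEst G d η ℓ (history I ω) t i v ^ n) μ :=
  hI.integrable (t := t + 1)
    (f := fun h => prob G d η ℓ h t i v * lossEst G d η ℓ h t i v ^ n) fun h h' hh => by
    simp only [prob_congr_of_Ico (G := G) (d := d) (η := η) (ℓ := ℓ) (by omega : t ≤ t + 1 + d) hh,
      lossEst_congr_of_Ico (G := G) (d := d) (η := η) (ℓ := ℓ) hh]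

theorem integrable_sum_prob_mul_lossEst (hI : IsRun G d η ℓ μ I) (t : ℕ) (v : V) :
    Integrable (fun ω => ∑ i, prob G d η ℓ (history I ω) t i v *
      lossEst G d η ℓ (history I ω) t i v) μ :=
  integrable_finsetSum _ fun i _ => by simpa using hI.integrable_prob_mul_lossEst_pow t 1 i v

theorem integrable_prob_div_playedProb (hI : IsRun G d η ℓ μ I) (t : ℕ) (i : Fin K) (v : V) :
    Integrable (fun ω => prob G d η ℓ (history I ω) t i v /
      playedProb G d (prob G d η ℓ (history I ω) t) i v) μ :=
  hI.integrable (t := t)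
    (f := fun h => prob G d η ℓ h t i v / playedProb G d (prob G d η ℓ h t) i v) fun h h' hh => by
    simp only [prob_congr_of_Ico (G := G) (η := η) (ℓ := ℓ) (Nat.le_add_right t d) hh]

/-- The expected loss of an agent, given the past. -/
theorem integral_loss (hI : IsRun G d η ℓ μ I) {s : ℕ} (hs : 1 ≤ s) (v : V) :
    ∫ ω, ℓ s (I s v ω) ∂μ = ∫ ω, ∑ i, prob G d η ℓ (history I ω) s i v * ℓ s i ∂μ := by
  classical
  refine (hI.integral_step hs (f := fun a _ => ℓ s (a v)) fun _ _ _ _ => rfl).trans ?_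
  simp only [sum_prod_mul_apply (fun u => sum_prob G d η ℓ _ s u)]

theorem integral_mul_playedInd (hI : IsRun G d η ℓ μ I) {s : ℕ} (hs : 1 ≤ s) (i : Fin K) (v : V)
    {c : (ℕ → V → Fin K) → ℝ} (hc : DependsOn c (Set.Ico 1 s)) :
    ∫ ω, c (history I ω) * playedInd G d (history I ω s) i v ∂μ =
      ∫ ω, c (history I ω) * playedProb G d (prob G d η ℓ (history I ω) s) i v ∂μ := by
  classical
  refine (hI.integral_step hs (f := fun a h => c h * playedInd G d a i v)
    fun a h h' hh => by simp only [hc hh]).trans ?_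
  simp only [mul_left_comm _ (c _), ← Finset.mul_sum,
    sum_prod_mul_playedInd G d (fun u => sum_prob G d η ℓ _ s u)]

/-- The loss estimates are conditionally unbiased. -/
theorem integral_mul_lossEst (hI : IsRun G d η ℓ μ I) {s : ℕ} (hs : 1 ≤ s) (i : Fin K) (v : V)
    {c : (ℕ → V → Fin K) → ℝ} (hc : DependsOn c (Set.Ico 1 s)) :
    ∫ ω, c (history I ω) * lossEst G d η ℓ (history I ω) (s + d) i v ∂μ =
      ∫ ω, c (history I ω) * ℓ s i ∂μ := by
  simp only [lossEst_add G d η ℓ _ s hs, ← mul_assoc]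
  refine (hI.integral_mul_playedInd hs i v
    (c := fun h => c h * (ℓ s i / playedProb G d (prob G d η ℓ h s) i v)) ?_).trans ?_
  · intro h h' hh
    simp only [hc hh, prob_congr_of_Ico (G := G) (η := η) (ℓ := ℓ) (Nat.le_add_right s d) hh]
  · simp only [mul_assoc, div_mul_cancel₀ _ (playedProb_prob_pos G d η ℓ _ s i v).ne']

theorem integral_mul_lossEst_sq (hI : IsRun G d η ℓ μ I) {s : ℕ} (hs : 1 ≤ s) (i : Fin K) (v : V)
    {c : (ℕ → V → Fin K) → ℝ} (hc : DependsOn c (Set.Ico 1 s)) :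
    ∫ ω, c (history I ω) * lossEst G d η ℓ (history I ω) (s + d) i v ^ 2 ∂μ =
      ∫ ω, c (history I ω) *
        (ℓ s i ^ 2 / playedProb G d (prob G d η ℓ (history I ω) s) i v) ∂μ := by
  simp only [lossEst_add G d η ℓ _ s hs, mul_pow, playedInd_sq, ← mul_assoc]
  refine (hI.integral_mul_playedInd hs i v
    (c := fun h => c h * (ℓ s i / playedProb G d (prob G d η ℓ h s) i v) ^ 2) ?_).trans ?_
  · intro h h' hh
    simp only [hc hh, prob_congr_of_Ico (G := G) (η := η) (ℓ := ℓ) (Nat.le_add_right s d) hh]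
  · refine integral_congr_ae (Filter.Eventually.of_forall fun ω => ?_)
    have := (playedProb_prob_pos G d η ℓ (history I ω) s i v).ne'
    dsimp only
    field_simp

-- This allows `p_{s+d}` to serve as the coefficient `c` when the actions of round `s` are averaged
-- out.
omit [NeZero K] in
theorem dependsOn_prob_add (s : ℕ) (i : Fin K) (v : V) :
    DependsOn (fun h => prob G d η ℓ h (s + d) i v) (Set.Ico 1 s) := fun h h' hh => by
  simp only [prob_congr_of_Ico (G := G) (η := η) (ℓ := ℓ) le_rfl hh]

theorem integral_sum_prob_mul_lossEst (hI : IsRun G d η ℓ μ I) {s : ℕ} (hs : 1 ≤ s) (v : V) :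
    ∫ ω, ∑ i, prob G d η ℓ (history I ω) (s + d) i v *
        lossEst G d η ℓ (history I ω) (s + d) i v ∂μ =
      ∫ ω, ∑ i, prob G d η ℓ (history I ω) (s + d) i v * ℓ s i ∂μ := by
  rw [integral_finsetSum _ fun i _ => by
      simpa using hI.integrable_prob_mul_lossEst_pow (s + d) 1 i v,
    integral_finsetSum _ fun i _ => ?_]
  · exact Finset.sum_congr rfl fun i _ => hI.integral_mul_lossEst hs i v (dependsOn_prob_add s i v)
  · exact (hI.integrable (dependsOn_prob_add s i v)).mul_const _

theorem integral_sum_prob_mul_lossEst_le_one (hI : IsRun G d η ℓ μ I)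
    (hℓ : ∀ t, 1 ≤ t → ∀ i, ℓ t i ∈ Set.Icc (0 : ℝ) 1) (t : ℕ) (v : V) :
    ∫ ω, ∑ i, prob G d η ℓ (history I ω) t i v * lossEst G d η ℓ (history I ω) t i v ∂μ ≤ 1 := by
  rcases Nat.lt_or_ge d t with hdt | hdt
  · obtain ⟨s, rfl⟩ : ∃ s, t = s + d := ⟨t - d, by omega⟩
    have hs : 1 ≤ s := by omega
    rw [hI.integral_sum_prob_mul_lossEst hs]
    refine (integral_mono (hI.integrable_prob_mul _ v _) (integrable_const 1) fun ω => ?_).trans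
      (by simp)
    rw [← sum_prob G d η ℓ (history I ω) (s + d) v]
    exact Finset.sum_le_sum fun i _ =>
      mul_le_of_le_one_right (prob_pos G d η ℓ _ _ i v).le (hℓ s hs i).2
  · simp [lossEst_of_le G d η ℓ _ hdt]

/-- Averaging leaves `p_{s+d} / q_s`; passing to `e p_s / q_s` puts numerator and denominator at the
same round, as the graph bound requires. -/
theorem integral_prob_mul_lossEst_sq_le (hI : IsRun G d η ℓ μ I) (hη : 0 ≤ η)
    (hη' : η * (K * Real.exp 1 * (d + 1)) ≤ 1)
    (hℓ : ∀ t, 1 ≤ t → ∀ i, ℓ t i ∈ Set.Icc (0 : ℝ) 1) {s : ℕ} (hs : 1 ≤ s) (i : Fin K) (v : V) :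
    ∫ ω, prob G d η ℓ (history I ω) (s + d) i v *
        lossEst G d η ℓ (history I ω) (s + d) i v ^ 2 ∂μ ≤
      Real.exp 1 * ∫ ω, prob G d η ℓ (history I ω) s i v /
        playedProb G d (prob G d η ℓ (history I ω) s) i v ∂μ := by
  rw [hI.integral_mul_lossEst_sq hs i v (dependsOn_prob_add s i v), ← integral_const_mul]
  refine integral_mono ?_ ((hI.integrable_prob_div_playedProb s i v).const_mul _) fun ω => ?_
  · refine hI.integrable (t := s) (f := fun h => prob G d η ℓ h (s + d) i v *
        (ℓ s i ^ 2 / playedProb G d (prob G d η ℓ h s) i v)) fun h h' hh => ?_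
    simp only [prob_congr_of_Ico (G := G) (η := η) (ℓ := ℓ) le_rfl hh,
      prob_congr_of_Ico (G := G) (η := η) (ℓ := ℓ) (Nat.le_add_right s d) hh]
  · have hq := playedProb_prob_pos G d η ℓ (history I ω) s i v
    have h1 := prob_add_le G d (history I ω) hη hη' hℓ hs i v
    have h2 : ℓ s i ^ 2 ≤ 1 := pow_le_one₀ (hℓ s hs i).1 (hℓ s hs i).2
    calc _ = prob G d η ℓ (history I ω) (s + d) i v * ℓ s i ^ 2 /
          playedProb G d (prob G d η ℓ (history I ω) s) i v := (mul_div_assoc _ _ _).symm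
      _ ≤ Real.exp 1 * prob G d η ℓ (history I ω) s i v /
          playedProb G d (prob G d η ℓ (history I ω) s) i v :=
        div_le_div_of_nonneg_right
          ((mul_le_of_le_one_right (prob_pos G d η ℓ _ _ i v).le h2).trans h1) hq.le
      _ = _ := mul_div_assoc _ _ _

theorem integral_sum_mul_prob_sub_le (hI : IsRun G d η ℓ μ I) (hη : 0 ≤ η)
    (hℓ : ∀ t, 1 ≤ t → ∀ i, ℓ t i ∈ Set.Icc (0 : ℝ) 1) {s : ℕ} (hs : 1 ≤ s) (v : V) :
    ∫ ω, ∑ i, prob G d η ℓ (history I ω) s i v * ℓ s i ∂μ -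
      ∫ ω, ∑ i, prob G d η ℓ (history I ω) (s + d) i v * ℓ s i ∂μ ≤ η * d := by
  rw [← integral_sub (hI.integrable_prob_mul _ v _) (hI.integrable_prob_mul _ v _)]
  refine (integral_mono ((hI.integrable_prob_mul _ v _).sub (hI.integrable_prob_mul _ v _))
    ((integrable_finsetSum _ fun m _ => hI.integrable_sum_prob_mul_lossEst (s + m) v).const_mul η)
    fun ω => sum_mul_prob_sub_le G d (history I ω) hη hℓ hs v d).trans ?_
  rw [integral_const_mul, integral_finsetSum _ fun m _ => hI.integrable_sum_prob_mul_lossEst _ v]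
  refine mul_le_mul_of_nonneg_left ?_ hη
  simpa using Finset.sum_le_card_nsmul (Finset.range d) _ 1 fun m _ =>
    hI.integral_sum_prob_mul_lossEst_le_one hℓ (s + m) v

/-- The regret of a single agent. -/
theorem agent_regret_le (hI : IsRun G d η ℓ μ I) (hη : 0 < η)
    (hη' : η * (K * Real.exp 1 * (d + 1)) ≤ 1)
    (hℓ : ∀ t, 1 ≤ t → ∀ i, ℓ t i ∈ Set.Icc (0 : ℝ) 1) (v : V) (k : Fin K) (T : ℕ) :
    ∫ ω, ∑ t ∈ Finset.Icc 1 T, ℓ t (I t v ω) ∂μ - ∑ t ∈ Finset.Icc 1 T, ℓ t k ≤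
      η * d * T + Real.log K / η + η / 2 * (Real.exp 1 * ∑ s ∈ Finset.Icc 1 T, ∑ i,
        ∫ ω, prob G d η ℓ (history I ω) s i v /
          playedProb G d (prob G d η ℓ (history I ω) s) i v ∂μ) := by
  have hloss : ∫ ω, ∑ t ∈ Finset.Icc 1 T, ℓ t (I t v ω) ∂μ =
      ∑ t ∈ Finset.Icc 1 T, ∫ ω, ∑ i, prob G d η ℓ (history I ω) t i v * ℓ t i ∂μ := by
    rw [integral_finsetSum _ fun t _ => ?_]
    · exact Finset.sum_congr rfl fun t ht => hI.integral_loss (Finset.mem_Icc.1 ht).1 v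
    · exact hI.integrable (t := t + 1) (f := fun h => ℓ t (h t v)) fun h h' hh => by
        rcases Nat.eq_zero_or_pos t with rfl | ht'
        · simp_all
        · simp only [hh t ⟨ht', Nat.lt_succ_self t⟩]
  have hdrift : ∑ s ∈ Finset.Icc 1 T,
      (∫ ω, ∑ i, prob G d η ℓ (history I ω) s i v * ℓ s i ∂μ -
        ∫ ω, ∑ i, prob G d η ℓ (history I ω) (s + d) i v * ℓ s i ∂μ) ≤ η * d * T := by
    have := Finset.sum_le_card_nsmul (Finset.Icc 1 T) _ (η * d) fun s hs =>
      hI.integral_sum_mul_prob_sub_le hη.le hℓ (Finset.mem_Icc.1 hs).1 v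
    simpa [mul_comm] using this
  have hint : ∀ s, Integrable (fun ω => ∑ i, prob G d η ℓ (history I ω) (s + d) i v *
      lossEst G d η ℓ (history I ω) (s + d) i v - lossEst G d η ℓ (history I ω) (s + d) k v) μ :=
    fun s => (hI.integrable_sum_prob_mul_lossEst (s + d) v).sub (hI.integrable_lossEst (s + d) k v)
  have hint2 := fun s => integrable_finsetSum Finset.univ fun i _ =>
    hI.integrable_prob_mul_lossEst_pow (s + d) 2 i v
  have hhedge := integral_mono (integrable_finsetSum (Finset.Icc 1 T) fun s _ => hint s)
    ((integrable_const (Real.log K / η)).add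
      ((integrable_finsetSum (Finset.Icc 1 T) fun s _ => hint2 s).const_mul (η / 2)))
    fun ω => sum_lossEst_regret_le G d (history I ω) hη hℓ v k T
  have hleft : ∫ ω, ∑ s ∈ Finset.Icc 1 T,
      (∑ i, prob G d η ℓ (history I ω) (s + d) i v * lossEst G d η ℓ (history I ω) (s + d) i v -
        lossEst G d η ℓ (history I ω) (s + d) k v) ∂μ =
      ∑ s ∈ Finset.Icc 1 T,
        (∫ ω, ∑ i, prob G d η ℓ (history I ω) (s + d) i v * ℓ s i ∂μ - ℓ s k) := by
    rw [integral_finsetSum _ fun s _ => hint s]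
    refine Finset.sum_congr rfl fun s hs => ?_
    have hs := (Finset.mem_Icc.1 hs).1
    -- The constant coefficient 1 gives unbiasedness for the comparator `k`.
    have h1 := hI.integral_mul_lossEst hs k v (c := fun _ => 1) fun _ _ _ => rfl
    rw [integral_sub (hI.integrable_sum_prob_mul_lossEst (s + d) v)
      (hI.integrable_lossEst (s + d) k v), hI.integral_sum_prob_mul_lossEst hs]
    simp only [one_mul, integral_const, probReal_univ, one_smul] at h1
    rw [h1]
  have hright : ∫ ω, (Real.log K / η + η / 2 * ∑ s ∈ Finset.Icc 1 T,
      ∑ i, prob G d η ℓ (history I ω) (s + d) i v *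
        lossEst G d η ℓ (history I ω) (s + d) i v ^ 2) ∂μ ≤
      Real.log K / η + η / 2 * (Real.exp 1 * ∑ s ∈ Finset.Icc 1 T, ∑ i,
        ∫ ω, prob G d η ℓ (history I ω) s i v /
          playedProb G d (prob G d η ℓ (history I ω) s) i v ∂μ) := by
    rw [integral_add (integrable_const _)
      ((integrable_finsetSum (Finset.Icc 1 T) fun s _ => hint2 s).const_mul (η / 2)),
      integral_const_mul, integral_finsetSum _ fun s _ => hint2 s, integral_const, probReal_univ,
      one_smul, Finset.mul_sum (Finset.Icc 1 T) _ (Real.exp 1)]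
    refine add_le_add_right (mul_le_mul_of_nonneg_left (Finset.sum_le_sum fun s hs => ?_)
      (half_pos hη).le) _
    rw [integral_finsetSum _ fun i _ => hI.integrable_prob_mul_lossEst_pow (s + d) 2 i v,
      Finset.mul_sum]
    exact Finset.sum_le_sum fun i _ =>
      hI.integral_prob_mul_lossEst_sq_le hη.le hη' hℓ (Finset.mem_Icc.1 hs).1 i v
  have := hleft.symm.trans_le (hhedge.trans hright)
  rw [hloss]
  rw [Finset.sum_sub_distrib] at this hdrift
  linarith

/-- The second-moment factors of all agents and actions at a round. -/
theorem sum_integral_prob_div_playedProb_le (hI : IsRun G d η ℓ μ I) (s : ℕ) :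
    ∑ v, ∑ i, ∫ ω, prob G d η ℓ (history I ω) s i v /
        playedProb G d (prob G d η ℓ (history I ω) s) i v ∂μ ≤
      (K * (graphPower G d).indepNum + Fintype.card V) / (1 - Real.exp (-1)) := by
  have hint := fun v => integrable_finsetSum Finset.univ fun i _ =>
    hI.integrable_prob_div_playedProb s i v
  have h1 : ∀ v, ∑ i, ∫ ω, prob G d η ℓ (history I ω) s i v /
        playedProb G d (prob G d η ℓ (history I ω) s) i v ∂μ =
      ∫ ω, ∑ i, prob G d η ℓ (history I ω) s i v /
        playedProb G d (prob G d η ℓ (history I ω) s) i v ∂μ := fun v =>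
    (integral_finsetSum _ fun i _ => hI.integrable_prob_div_playedProb s i v).symm
  simp only [h1]
  rw [← integral_finsetSum _ fun v _ => hint v]
  refine (integral_mono (integrable_finsetSum _ fun v _ => hint v) (integrable_const
    ((K * (graphPower G d).indepNum + Fintype.card V) / (1 - Real.exp (-1)))) fun ω => ?_).trans
    (by simp)
  dsimp only
  rw [Finset.sum_comm]
  refine (Finset.sum_le_sum fun i _ => sum_div_playedProb_le G d
    (prob_pos G d η ℓ (history I ω) s) (prob_le_one G d η ℓ (history I ω) s) i).trans_eq ?_
  -- The independence number is counted once per action, whereas each agent's probabilities sum to 1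
  -- over the actions.
  rw [← Finset.sum_div, Finset.sum_add_distrib, Finset.sum_comm]
  simp [sum_prob]

end IsRun

end Exp3Coop

/-! ### Averaging over agents and tuning the constants -/

theorem mainTheorem1 {V : Type*} [Fintype V] (G : SimpleGraph V) (hG : G.Connected)
    (K : ℕ) [NeZero K] (d : ℕ) (γ : ℝ) (hγ : γ ∈ Set.Ioc (0 : ℝ) 1)
    (ℓ : ℕ → Fin K → ℝ) (hℓ : ∀ t, 1 ≤ t → ∀ i, ℓ t i ∈ Set.Icc (0 : ℝ) 1)
    {Ω : Type*} [MeasurableSpace Ω] (μ : Measure Ω) [IsProbabilityMeasure μ]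
    (I : ℕ → V → Ω → Fin K)
    (hI : Exp3Coop.IsRun G d (γ / (K * Real.exp 1 * (d + 1))) ℓ μ I) (T : ℕ) :
    Exp3Coop.regret ℓ μ I T ≤
      2 * d + K * Real.exp 1 * (d + 1) * Real.log K / γ +
        γ * ((Exp3Coop.graphPower G d).indepNum /
              (2 * (1 - Real.exp (-1)) * (d + 1) * Fintype.card V) +
            3 / (K * Real.exp 1)) * T := by
  have := hG.nonempty
  have hγ0 : γ ≠ 0 := hγ.1.ne'
  have hK : (0 : ℝ) < K := Nat.cast_pos.2 (Nat.pos_of_ne_zero (NeZero.ne K))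
  have hN : (0 : ℝ) < Fintype.card V := Nat.cast_pos.2 Fintype.card_pos
  have hd : (0 : ℝ) ≤ d := Nat.cast_nonneg d
  have he := Real.exp_pos 1
  have hb := Exp3Coop.one_sub_exp_neg_one_pos
  set D : ℝ := K * Real.exp 1 * (d + 1) with hD
  have hDpos : 0 < D := by positivity
  set η := γ / D with hη
  have hηpos : 0 < η := div_pos hγ.1 hDpos
  have hη' : η * D ≤ 1 := (div_mul_cancel₀ γ hDpos.ne').trans_le hγ.2
  set b := 1 - Real.exp (-1) with hbdef
  set α : ℝ := Nat.cast (Exp3Coop.graphPower G d).indepNum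
  set N : ℝ := Nat.cast (Fintype.card V) with hNdef
  obtain ⟨k, -, hk⟩ := Finset.exists_mem_eq_inf' (Finset.univ_nonempty (α := Fin K))
    fun i => ∑ t ∈ Finset.Icc 1 T, ℓ t i
  have hagents := Finset.sum_le_sum fun v (_ : v ∈ Finset.univ) =>
    hI.agent_regret_le hηpos hη' hℓ v k T
  rw [Finset.sum_sub_distrib, Finset.sum_add_distrib, ← Finset.mul_sum, ← Finset.mul_sum] at hagents
  simp only [Finset.sum_const, Finset.card_univ, nsmul_eq_mul, ← hNdef] at hagents
  have hmoment := Finset.sum_le_card_nsmul (Finset.Icc 1 T) _ ((K * α + N) / b) fun s _ =>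
    hI.sum_integral_prob_div_playedProb_le s
  rw [Finset.sum_comm, Nat.card_Icc, Nat.add_sub_cancel, nsmul_eq_mul] at hmoment
  have htotal := hagents.trans (add_le_add_right (mul_le_mul_of_nonneg_left
    (mul_le_mul_of_nonneg_left hmoment he.le) (half_pos hηpos).le) _)
  have hregret : Exp3Coop.regret ℓ μ I T ≤
      η * d * T + Real.log K / η + η / 2 * (Real.exp 1 * (T * ((K * α + N) / b))) / N := by
    rw [Exp3Coop.regret, hk, ← hNdef]
    refine le_of_mul_le_mul_left ?_ hN
    calc _ = _ := by field_simp
      _ ≤ _ := htotal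
      _ = _ := by field_simp
  -- The drift contributes `d` and the second moment `e / (2b) = e² / (2(e - 1)) ≈ 2.15`, which is
  -- the source of the constant 3.
  have hconst : (d : ℝ) + Real.exp 1 / (2 * b) ≤ 3 * (d + 1) := by
    have hb' : b = 1 - (Real.exp 1)⁻¹ := by rw [hbdef, Real.exp_neg]
    have he1 := Real.exp_one_gt_d9
    have he2 := Real.exp_one_lt_d9
    have : Real.exp 1 / (2 * b) ≤ 3 := by
      rw [div_le_iff₀ (by positivity), hb', mul_sub, mul_sub]
      have : (Real.exp 1)⁻¹ ≤ 1 / 2 := by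
        rw [one_div]; exact inv_anti₀ (by norm_num) (by linarith)
      linarith
    linarith
  have hsplit : η * d * T + η / 2 * (Real.exp 1 * (T * ((K * α + N) / b))) / N =
      γ * (α / (2 * b * (d + 1) * N) + (d + Real.exp 1 / (2 * b)) / D) * T := by
    rw [hη, hD]
    field_simp
    ring
  have hlast : (d + Real.exp 1 / (2 * b)) / D ≤ 3 / (K * Real.exp 1) := by
    rw [div_le_div_iff₀ hDpos (by positivity), hD]
    calc _ ≤ 3 * (d + 1) * (K * Real.exp 1) := mul_le_mul_of_nonneg_right hconst (by positivity)
      _ = _ := by ring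
  have hfinal : γ * (α / (2 * b * (d + 1) * N) + (d + Real.exp 1 / (2 * b)) / D) * T ≤
      γ * (α / (2 * b * (d + 1) * N) + 3 / (K * Real.exp 1)) * T :=
    mul_le_mul_of_nonneg_right (mul_le_mul_of_nonneg_left (add_le_add_right hlast _) hγ.1.le)
      (Nat.cast_nonneg T)
  have hlog : Real.log K / η = D * Real.log K / γ := by
    rw [hη, div_div_eq_mul_div, mul_comm]
  -- The bound obtained has no additive `2 * d`; this nonnegative term is simply added.
  linarith
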